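/- For a topological space $X$ let $C(X)$ be the linear space of continuous functions $X\to\mathbb R$ and $C^*(X)$ its subspace of bounded functions; $C_p(X)$ and $C_p^*(X)$ denote these spaces with the topology of pointwise convergence. Let $D$ be either $C$ or $C^*$ (the same choice for both spaces below). A map $T\colon D_p(X)\to D_p(Y)$ is uniformly continuous if for every neighborhood $U$ of $0$ in $D_p(Y)$ there is a neighborhood $V$ of $0$ in $D_p(X)$ such that $f,g\in D_p(X)$ and $f-g\in V$ imply $T(f)-T(g)\in U$. It is inversely bounded if for every sequence $(g_n)_{n\ge 1}$ in $C^*(Y)$ with $\sup_n\|g_n\|_\infty<\infty$ there is a sequence $(f_n)_{n\ge 1}$ in $C^*(X)$ with $\sup_n\|f_n\|_\infty<\infty$ and $T(f_n)=g_n$ for all $n$. A perfect map is a continuous closed map with compact fibers (not necessarily surjective). **Theorem.** Let $X$ and $Y$ be metrizable spaces, and let $T\colon D_p(X)\to D_p(Y)$ be a uniformly continuous inversely bounded surjection. Let $\mathcal P$ be any topological property of metrizable spaces such that (a) if $Z\in\mathcal P$ and $F\subset Z$ is closed, then $F\in\mathcal P$; (b) if $Z,W\in\mathcal P$, then $Z\times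 W\in\mathcal P$; (c) if a metrizable space $Z$ is the union of closed subsets $F_n$, $n\ge 1$, with each $F_n\in\mathcal P$, then $Z\in\mathcal P$; (d) if $Z$ and $W$ are metrizable, $f\colon Z\to W$ is a perfect map with finite fibers and $W\in\mathcal P$, then $Z\in\mathcal P$. If $X\in\mathcal P$, then $Y\in\mathcal P$. -/

import Mathlib

open scoped Topology Uniformity

universe u

/-- The two kinds of function spaces: `all` stands for `C`, `bounded` stands for `C*`. -/
inductive FunKind where
  | all
  | bounded

/-- `C(X)`: the continuous real-valued functions on `X`, as a linear subspace of `X → ℝ`. Its type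
of elements carries the topology and uniformity induced by the product `X → ℝ`, that is, those of
pointwise convergence, so it is `C_p(X)`. -/
def CSpace (X : Type u) [TopologicalSpace X] : Submodule ℝ (X → ℝ) where
  carrier := {f | Continuous f}
  add_mem' hf hg := Continuous.add hf hg
  zero_mem' := continuous_const
  smul_mem' c _ hf := Continuous.const_smul hf c

/-- `C*(X)`: the bounded continuous real-valued functions on `X`, as a linear subspace of `X → ℝ`;
with the induced topology and uniformity it is `C_p*(X)`. -/
def CStarSpace (X : Type u) [TopologicalSpace X] : Submodule ℝ (X → ℝ) where
  carrier := {f | Continuous f ∧ ∃ M : ℝ, ∀ x, |f x| ≤ M}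
  add_mem' := by
    rintro f g ⟨hf, M, hM⟩ ⟨hg, N, hN⟩
    exact ⟨hf.add hg, M + N, fun x => (abs_add_le _ _).trans (add_le_add (hM x) (hN x))⟩
  zero_mem' := ⟨continuous_const, 0, fun x => by simp⟩
  smul_mem' := by
    rintro c f ⟨hf, M, hM⟩
    refine ⟨hf.const_smul c, |c| * M, fun x => ?_⟩
    simpa [abs_mul] using mul_le_mul_of_nonneg_left (hM x) (abs_nonneg c)

/-- `D(X)`, which is `C(X)` or `C*(X)`, with the topology and the uniformity of pointwise
convergence inherited from `X → ℝ`. -/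
def FunKind.Dp (D : FunKind) (X : Type u) [TopologicalSpace X] : Submodule ℝ (X → ℝ) :=
  match D with
  | .all => CSpace X
  | .bounded => CStarSpace X

/-- A sequence of functions is norm bounded: some `M > 0` bounds the sup norms of all its terms. -/
def NormBoundedSeq {X : Type u} (f : ℕ → X → ℝ) : Prop :=
  ∃ M : ℝ, 0 < M ∧ ∀ n x, |f n x| ≤ M

/-- `T : D(X) → D(Y)` is inversely bounded: every norm bounded sequence of bounded continuous
functions on `Y` lifts through `T` to a norm bounded sequence of bounded continuous functions
on `X`. (Norm boundedness of a sequence in `D` already places it in `C*`.) -/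
def InverselyBounded {D : FunKind} {X Y : Type u} [TopologicalSpace X] [TopologicalSpace Y]
    (T : D.Dp X → D.Dp Y) : Prop :=
  ∀ g : ℕ → D.Dp Y, NormBoundedSeq (fun n => (g n : Y → ℝ)) →
    ∃ f : ℕ → D.Dp X, NormBoundedSeq (fun n => (f n : X → ℝ)) ∧ ∀ n, T (f n) = g n

/-- A perfect map with finite fibres. (`IsProperMap` says continuous, closed and with compact
fibres; surjectivity is not required.) -/
def IsPerfectFiniteFibres {Z W : Type u} [TopologicalSpace Z] [TopologicalSpace W]
    (f : Z → W) : Prop :=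
  IsProperMap f ∧ ∀ w, (f ⁻¹' {w}).Finite

/-! Uniform continuity for pointwise convergence makes the value of `T f` at `y` depend, up to a
bounded error, on finitely many points of `X`: if `f` and `g` differ by less than 1 there, the
images at `y` differ by at most some `q`. Bounded functions on `X` are viewed as functions on the
compact space `StoneCech X`, where limits of controlling tuples exist, so the sets `controlledSet S
p q` are closed.

Two finite controlling sets intersect in a controlling set, with errors added (`Controls.inter`).
Hence each `y` has a least one, and inverse boundedness makes it nonempty. On `controlledSet S (p +
1) q \ controlledSet S p (2 * q)` the `(p + 1)`-point `q`-controlling set is unique, so it varies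
continuously and can be ordered continuously near each point. These pieces are Fσ; gluing gives
countably many closed sets with continuous tuples in `StoneCech X`. The points whose tuples lie in
`X` form closed sets, since `X` is sequentially closed there, and these sets still cover `Y`.

The resulting maps into powers of `X` are perfect with finite fibres
(`isPerfectFiniteFibres_of_controls`): otherwise bounded functions on `Y` separated by `q + 1` would
have bounded lifts, two of which are close on a controlling set by pigeonhole. The closure
properties of `P` finish the proof. -/

open Set Filter Topology

/-! ### Sequences and the Stone–Čech compactification -/

/-- A sequence without cluster points has a subsequence (in the weak sense of an injective
reindexing) which is a closed embedding of the discrete space `ℕ`. -/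
lemma exists_injective_isClosedEmbedding_comp {X : Type*} [TopologicalSpace X] [T1Space X]
    (s : ℕ → X) (hs : ∀ x, ¬ MapClusterPt x atTop s) :
    ∃ k : ℕ → ℕ, Function.Injective k ∧ IsClosedEmbedding (s ∘ k) := by
  have hlf : LocallyFinite fun j => ({s j} : Set X) := by
    intro x
    have h := hs x
    rw [mapClusterPt_iff_frequently] at h
    push Not at h
    obtain ⟨U, hU, hfin⟩ := h
    refine ⟨U, hU, ?_⟩
    rw [← Nat.cofinite_eq_atTop, eventually_cofinite] at hfin
    refine hfin.subset ?_
    rintro j ⟨_, rfl, hj⟩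
    simpa using hj
  have hinf : (range s).Infinite := by
    intro hfin
    have : ∃ x ∈ range s, (s ⁻¹' {x}).Infinite := by
      by_contra! hcon
      refine infinite_univ (α := ℕ) ((hfin.biUnion hcon).subset fun n _ => ?_)
      exact mem_biUnion (mem_range_self n) rfl
    obtain ⟨x, -, hx⟩ := this
    refine hx ((hlf.point_finite x).subset fun n hn => ?_)
    exact (mem_preimage.1 hn).symm
  let e : ℕ ↪ range s := hinf.natEmbedding
  choose k hk using fun n => (e n).2
  have hinj : Function.Injective (s ∘ k) := fun a b hab =>
    e.injective (Subtype.ext (by rw [← hk a, ← hk b]; exact hab))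
  have hk' : Function.Injective k := fun a b hab => hinj (congrArg s hab)
  refine ⟨k, hk', .of_continuous_injective_isClosedMap continuous_of_discreteTopology hinj ?_⟩
  intro t _
  have : (s ∘ k) '' t = ⋃ i : t, {s (k i)} := by ext; simp [eq_comm]
  rw [this]
  exact (hlf.comp_injective (hk'.comp Subtype.val_injective)).isClosed_iUnion
    fun _ => isClosed_singleton

/-- A bounded continuous function extends over the Stone–Čech compactification. -/
lemma exists_stoneCech_extension {X : Type u} [TopologicalSpace X] (f : X → ℝ) (hf : Continuous f)
    (M : ℝ) (hM : ∀ x, |f x| ≤ M) :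
    ∃ F : C(StoneCech X, ℝ), (∀ x, F (stoneCechUnit x) = f x) ∧ ∀ b, |F b| ≤ M := by
  have hg : Continuous fun x => (⟨f x, abs_le.1 (hM x)⟩ : Icc (-M) M) := hf.subtype_mk _
  refine ⟨⟨fun b => ((stoneCechExtend hg b : Icc (-M) M) : ℝ),
    continuous_subtype_val.comp (continuous_stoneCechExtend hg)⟩, fun x => ?_, fun b => ?_⟩
  · simp [stoneCechExtend_stoneCechUnit]
  · exact abs_le.2 (stoneCechExtend hg b : Icc (-M) M).2

/-- A normal space is sequentially closed in its Stone–Čech compactification. -/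
lemma mem_range_stoneCechUnit_of_tendsto {X : Type u} [TopologicalSpace X] [T4Space X]
    (s : ℕ → X) (b : StoneCech X) (h : Tendsto (fun n => stoneCechUnit (s n)) atTop (𝓝 b)) :
    b ∈ range (stoneCechUnit : X → StoneCech X) := by
  by_cases hs : ∀ x, ¬ MapClusterPt x atTop s
  · exfalso
    obtain ⟨k, hk, hemb⟩ := exists_injective_isClosedEmbedding_comp s hs
    -- Alternating signs on a closed discrete subsequence extend to `X` by Tietze and then to
    -- `StoneCech X`; convergence to `b` would make them converge.
    let g : BoundedContinuousFunction ℕ ℝ :=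
      BoundedContinuousFunction.ofNormedAddCommGroup (fun j => (-1 : ℝ) ^ j)
        continuous_of_discreteTopology 1 (fun j => by simp)
    obtain ⟨G, -, hG⟩ :=
      BoundedContinuousFunction.exists_extension_norm_eq_of_isClosedEmbedding g hemb
    obtain ⟨F, hF, -⟩ := exists_stoneCech_extension G G.continuous ‖G‖ G.norm_coe_le_norm
    have h1 : Tendsto (fun j => F (stoneCechUnit (s (k j)))) atTop (𝓝 (F b)) :=
      (F.continuous.tendsto b).comp (h.comp hk.nat_tendsto_atTop)
    have h2 : (fun j => F (stoneCechUnit (s (k j)))) = fun j => (-1 : ℝ) ^ j := by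
      funext j
      rw [hF]
      exact congrFun hG j
    rw [h2] at h1
    have he := h1.comp (tendsto_id.nsmul_atTop (two_pos : 0 < 2))
    have ho := h1.comp ((tendsto_add_atTop_nat 1).comp (tendsto_id.nsmul_atTop (two_pos : 0 < 2)))
    simp only [Function.comp_def, smul_eq_mul, id, pow_mul, pow_succ] at he ho
    norm_num at he ho
    linarith [he.trans ho.symm]
  · push Not at hs
    obtain ⟨x, hx⟩ := hs
    have h1 : MapClusterPt (stoneCechUnit x) atTop (fun n => stoneCechUnit (s n)) :=
      hx.continuousAt_comp continuous_stoneCechUnit.continuousAt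
    refine ⟨x, ?_⟩
    by_contra hne
    obtain ⟨U, V, hU, hV, hxU, hbV, hd⟩ := t2_separation hne
    have h2 := (h1.frequently (hU.mem_nhds hxU)).and_eventually (h.eventually (hV.mem_nhds hbV))
    obtain ⟨n, hn1, hn2⟩ := h2.exists
    exact disjoint_left.1 hd hn1 hn2

/-! ### Discrete refinements and gluing -/

/-- Stone's refinement: an open family in a metric space has a `σ`-discrete closed refinement. -/
lemma exists_sigma_discrete_closed_refinement {Y ι : Type*} [MetricSpace Y] (U : ι → Set Y)
    (hU : ∀ a, IsOpen (U a)) :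
    ∃ C : ℕ → ι → Set Y, (∀ m a, IsClosed (C m a)) ∧ (∀ m a, C m a ⊆ U a) ∧
      (∀ m, Pairwise (Function.onFun Disjoint (C m))) ∧ (∀ m, LocallyFinite (C m)) ∧
      (⋃ a, U a) ⊆ ⋃ m, ⋃ a, C m a := by
  let : LinearOrder ι := WellOrderingRel.isWellOrder.linearOrder
  have : WellFoundedLT ι := ⟨WellOrderingRel.isWellOrder.toIsWellFounded.wf⟩
  -- If `a < b`, a point of `C m b` lies outside `U a`, hence at distance at least `1 / (m + 1)`
  -- from `C m a`.
  let C : ℕ → ι → Set Y := fun m a =>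
    {y | (∀ z ∉ U a, 1 / ((m : ℝ) + 1) ≤ dist y z) ∧ ∀ b < a, y ∉ U b}
  have hpos : ∀ m : ℕ, 0 < 1 / ((m : ℝ) + 1) := fun m => by positivity
  have hsub : ∀ m a, C m a ⊆ U a := by
    intro m a y hy
    by_contra hyU
    have := hy.1 y hyU
    rw [dist_self] at this
    linarith [hpos m]
  have hsep : ∀ m a b y z, y ∈ C m a → z ∈ C m b → dist y z < 1 / ((m : ℝ) + 1) → a = b := by
    have key : ∀ m a b y z, y ∈ C m a → z ∈ C m b → dist y z < 1 / ((m : ℝ) + 1) → ¬ a < b := by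
      intro m a b y z hy hz hd hab
      exact not_lt.2 (hy.1 z (hz.2 a hab)) hd
    intro m a b y z hy hz hd
    rcases lt_trichotomy a b with h | h | h
    · exact (key m a b y z hy hz hd h).elim
    · exact h
    · exact (key m b a z y hz hy (by rwa [dist_comm]) h).elim
  refine ⟨C, fun m a => ?_, hsub, fun m a b hab => ?_, fun m y => ?_, fun y hy => ?_⟩
  · have : C m a = (⋂ z, ⋂ (_ : z ∉ U a), {y | 1 / ((m : ℝ) + 1) ≤ dist y z}) ∩
        ⋂ b, ⋂ (_ : b < a), (U b)ᶜ := by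
      ext y
      simp [C]
    rw [this]
    refine IsClosed.inter (isClosed_iInter fun z => isClosed_iInter fun _ => ?_)
      (isClosed_iInter fun b => isClosed_iInter fun _ => (hU b).isClosed_compl)
    exact isClosed_le continuous_const (continuous_id.dist continuous_const)
  · refine disjoint_left.2 fun y hya hyb => hab (hsep m a b y y hya hyb ?_)
    rw [dist_self]
    exact hpos m
  · refine ⟨Metric.ball y (1 / ((m : ℝ) + 1) / 2), Metric.ball_mem_nhds _ (half_pos (hpos m)), ?_⟩
    refine Set.Subsingleton.finite ?_
    rintro a ⟨v, hva, hvy⟩ b ⟨w, hwb, hwy⟩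
    refine hsep m a b v w hva hwb ?_
    have := dist_triangle_right v w y
    rw [Metric.mem_ball] at hvy hwy
    linarith
  · have hne : {a | y ∈ U a}.Nonempty := mem_iUnion.1 hy
    let a := wellFounded_lt.min {a | y ∈ U a} hne
    have ha : y ∈ U a := wellFounded_lt.min_mem _ hne
    obtain ⟨ε, hε, hball⟩ := Metric.isOpen_iff.1 (hU a) y ha
    obtain ⟨m, hm⟩ := exists_nat_one_div_lt hε
    refine mem_iUnion.2 ⟨m, mem_iUnion.2 ⟨a, fun z hz => ?_, fun b hb hyb => ?_⟩⟩
    · by_contra! hlt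
      refine hz (hball ?_)
      rw [Metric.mem_ball, dist_comm]
      linarith
    · exact wellFounded_lt.not_lt_min {a | y ∈ U a} hyb hb

/-- Local continuous solutions over a closed subset of a metric space glue to continuous solutions
over countably many closed sets. -/
lemma exists_closed_cover_continuousOn {Y Z : Type*} [MetricSpace Y] [TopologicalSpace Z] [Nonempty Z]
    (H : Set Y) (hH : IsClosed H) (R : Y → Z → Prop)
    (hloc : ∀ y ∈ H, ∃ U : Set Y, IsOpen U ∧ y ∈ U ∧ ∃ κ : Y → Z, ContinuousOn κ (U ∩ H) ∧
      ∀ z ∈ U ∩ H, R z (κ z)) :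
    ∃ (E : ℕ → Set Y) (κ : ℕ → Y → Z), (∀ m, IsClosed (E m)) ∧ (⋃ m, E m) = H ∧
      (∀ m, ContinuousOn (κ m) (E m)) ∧ ∀ m, ∀ y ∈ E m, R y (κ m y) := by
  choose! U hUo hyU κ hκ hR using hloc
  obtain ⟨C, hCc, hCU, hCd, hCf, hCcov⟩ :=
    exists_sigma_discrete_closed_refinement (fun a : H => U a) fun a => hUo a a.2
  have hsel : ∀ m, ∃ η : Y → Z, ∀ a : H, EqOn η (κ a) (C m a) := by
    intro m
    classical
    refine ⟨fun y => if h : ∃ a : H, y ∈ C m a then κ h.choose y else κ y y, fun a y hy => ?_⟩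
    have h : ∃ a : H, y ∈ C m a := ⟨a, hy⟩
    have : h.choose = a := by
      by_contra hne
      exact disjoint_left.1 (hCd m hne) h.choose_spec hy
    simp only [dif_pos h, this]
  choose η hη using hsel
  have hsub : ∀ m a, C m a ∩ H ⊆ U a ∩ H := fun m a => inter_subset_inter_left _ (hCU m a)
  refine ⟨fun m => ⋃ a, C m a ∩ H, η, fun m => ?_, ?_, fun m => ?_, fun m y hy => ?_⟩
  · exact ((hCf m).subset fun a => inter_subset_left).isClosed_iUnion fun a => (hCc m a).inter hH
  · refine Subset.antisymm (iUnion_subset fun m => iUnion_subset fun a => inter_subset_right) ?_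
    intro y hy
    have := hCcov (mem_iUnion.2 ⟨⟨y, hy⟩, hyU y hy⟩)
    obtain ⟨m, hm⟩ := mem_iUnion.1 this
    obtain ⟨a, ha⟩ := mem_iUnion.1 hm
    exact mem_iUnion.2 ⟨m, mem_iUnion.2 ⟨a, ha, hy⟩⟩
  · refine ((hCf m).subset fun a => inter_subset_left).continuousOn_iUnion
      (fun a => (hCc m a).inter hH) fun a => ?_
    exact ((hκ a a.2).mono (hsub m a)).congr fun y hy => hη m a hy.1
  · obtain ⟨a, ha⟩ := mem_iUnion.1 hy
    rw [hη m a ha.1]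
    exact hR a a.2 y (hsub m a ha)

/-! ### Finite controlling sets -/

section Controls

variable {B Y : Type*} [TopologicalSpace B] [TopologicalSpace Y]

/-- The values of `F` on `K` control those of `S F` at `y`, up to an error of `q`. -/
def Controls (S : C(B, ℝ) → C(Y, ℝ)) (q : ℝ) (y : Y) (K : Set B) : Prop :=
  ∀ F G : C(B, ℝ), (∀ b ∈ K, |F b - G b| < 1) → |S F y - S G y| ≤ q

/-- Every bounded sequence of continuous functions lifts through `S` to a bounded sequence. -/
def LiftsBoundedSeqs (S : C(B, ℝ) → C(Y, ℝ)) : Prop :=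
  ∀ g : ℕ → C(Y, ℝ), (∃ M, ∀ n y, |g n y| ≤ M) →
    ∃ F : ℕ → C(B, ℝ), (∃ M, ∀ n b, |F n b| ≤ M) ∧ ∀ n, S (F n) = g n

/-- The points controlled by at most `p` points (at least one if `p ≠ 0`) with an error of `q`. -/
def controlledSet (S : C(B, ℝ) → C(Y, ℝ)) (p : ℕ) (q : ℝ) : Set Y :=
  {y | ∃ k : Fin p → B, Controls S q y (range k)}

variable {S : C(B, ℝ) → C(Y, ℝ)}

lemma Controls.mono {q r : ℝ} {y : Y} {K L : Set B} (h : Controls S q y K) (hq : q ≤ r)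
    (hK : K ⊆ L) : Controls S r y L :=
  fun F G hFG => (h F G fun b hb => hFG b (hK hb)).trans hq

lemma Controls.nonneg {q : ℝ} {y : Y} {K : Set B} (h : Controls S q y K) : 0 ≤ q :=
  (abs_nonneg _).trans (h 0 0 fun b _ => by simp)

lemma Controls.inter [NormalSpace B] [T1Space B] {q r : ℝ} {y : Y} {K L : Set B} (hKf : K.Finite)
    (hLf : L.Finite) (hK : Controls S q y K) (hL : Controls S r y L) :
    Controls S (q + r) y (K ∩ L) := by
  intro F G hFG
  obtain ⟨φ, h0, h1, -⟩ := exists_continuous_zero_one_of_isClosed hKf.isClosed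
    (hLf.subset (sdiff_subset (t := K))).isClosed disjoint_sdiff_right
  -- `E` interpolates: it equals `F` on `K` and `G` on `L \ K`, so it is compared with `F` through
  -- `K` and with `G` through `L`.
  let E : C(B, ℝ) := F + φ * (G - F)
  have hE1 : |S F y - S E y| ≤ q := hK F E fun b hb => by simp [E, h0 hb]
  have hE2 : |S E y - S G y| ≤ r := hL E G fun b hb => by
    by_cases hbK : b ∈ K
    · simpa [E, h0 hbK] using hFG b ⟨hbK, hb⟩
    · simp [E, h1 ⟨hb, hbK⟩]
  calc |S F y - S G y| ≤ |S F y - S E y| + |S E y - S G y| := abs_sub_le _ _ _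
    _ ≤ q + r := add_le_add hE1 hE2

/-- An empty control would keep all values at `y` within `q` of each other, whereas 0 and the
constant `q + 1` both have lifts. -/
lemma not_controls_empty (hS : LiftsBoundedSeqs S) (q : ℝ) (y : Y) : ¬ Controls S q y ∅ := by
  intro h
  have hq := h.nonneg
  obtain ⟨F, -, hF⟩ := hS (fun n => if n = 0 then 0 else .const Y (q + 1))
    ⟨q + 1, fun n y => by
      split_ifs
      · simp; linarith
      · simp [abs_of_nonneg (show 0 ≤ q + 1 by linarith)]⟩
  have := h (F 1) (F 0) (by simp)
  simp [hF, abs_of_nonneg (show 0 ≤ q + 1 by linarith)] at this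
  linarith

/-- Limits of controlling tuples control the limit point. -/
lemma exists_tendsto_controls [CompactSpace B] {ι : Type*} {p : ℕ} {q : ℝ} (u : Ultrafilter ι)
    {s : ι → Y} {y : Y} (hs : Tendsto s u (𝓝 y)) (k : ι → Fin p → B)
    (hk : ∀ᶠ i in (u : Filter ι), Controls S q (s i) (range (k i))) :
    ∃ c, Tendsto k u (𝓝 c) ∧ Controls S q y (range c) := by
  obtain ⟨c, -, hc⟩ := isCompact_univ.ultrafilter_le_nhds (u.map k) (by simp)
  refine ⟨c, hc, fun F G hFG => ?_⟩
  have hlim : Tendsto (fun i => |S F (s i) - S G (s i)|) u (𝓝 |S F y - S G y|) :=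
    ((((S F).continuous.tendsto y).comp hs).sub (((S G).continuous.tendsto y).comp hs)).abs
  -- The strict bound on the arguments is an open condition and the weak bound on the values a
  -- closed one, so control passes to limits.
  refine le_of_tendsto hlim ?_
  have hev : ∀ᶠ i in (u : Filter ι), ∀ j, |F (k i j) - G (k i j)| < 1 := by
    refine eventually_all.2 fun j => ?_
    have hj : Tendsto (fun i => k i j) u (𝓝 (c j)) := (tendsto_pi_nhds.1 hc) j
    exact ((((F.continuous.tendsto _).comp hj).sub ((G.continuous.tendsto _).comp hj)).abs).eventually
      (gt_mem_nhds (hFG _ (mem_range_self j)))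
  filter_upwards [hev, hk] with i hi hki
  exact hki F G (by rintro _ ⟨j, rfl⟩; exact hi j)

lemma isClosed_controlledSet [CompactSpace B] (p : ℕ) (q : ℝ) :
    IsClosed (controlledSet S p q) := by
  rw [isClosed_iff_ultrafilter]
  intro y u hu hmem
  by_cases hne : Nonempty (Fin p → B)
  · have hk : ∀ z, ∃ k : Fin p → B, z ∈ controlledSet S p q → Controls S q z (range k) := by
      intro z
      by_cases hz : z ∈ controlledSet S p q
      · exact ⟨hz.choose, fun _ => hz.choose_spec⟩
      · exact ⟨hne.some, fun h => (hz h).elim⟩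
    choose k hk using hk
    obtain ⟨c, -, hc⟩ := exists_tendsto_controls u (s := id) hu k
      (mem_of_superset hmem fun z hz => hk z hz)
    exact ⟨c, hc⟩
  · obtain ⟨z, k, -⟩ := u.nonempty_of_mem hmem
    exact (hne ⟨k⟩).elim

lemma mem_controlledSet_of_ncard_le [Nonempty B] {p : ℕ} {q : ℝ} {y : Y} {K : Set B}
    (hK : K.Finite) (hp : K.ncard ≤ p) (h : Controls S q y K) : y ∈ controlledSet S p q := by
  obtain rfl | hne := K.eq_empty_or_nonempty
  · exact ⟨fun _ => Classical.arbitrary B, h.mono le_rfl (empty_subset _)⟩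
  · have := hK.fintype
    have : Nonempty K := hne.to_subtype
    obtain ⟨e⟩ : Nonempty (K ↪ Fin p) := by
      rw [Function.Embedding.nonempty_iff_card_le, Fintype.card_fin, ← Nat.card_eq_fintype_card]
      exact hp
    refine ⟨fun i => (Function.invFun e i : K), h.mono le_rfl fun b hb => ⟨e ⟨b, hb⟩, ?_⟩⟩
    simp [Function.leftInverse_invFun e.injective ⟨b, hb⟩]

/-! ### Uniqueness and continuous selection of controlling tuples -/

section Unique

variable {p : ℕ} {q : ℝ} {y : Y}

lemma injective_of_controls (hy : y ∉ controlledSet S p (2 * q)) {k : Fin (p + 1) → B}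
    (hk : Controls S q y (range k)) : Function.Injective k := by
  have : Nonempty B := ⟨k 0⟩
  have hcard : (k '' univ).ncard = (univ : Set (Fin (p + 1))).ncard := by
    refine (ncard_image_le finite_univ).antisymm ?_
    by_contra! hlt
    rw [image_univ, ncard_univ, Nat.card_eq_fintype_card, Fintype.card_fin] at hlt
    exact hy (mem_controlledSet_of_ncard_le (finite_range k) (Nat.lt_succ_iff.1 hlt)
      (hk.mono (by linarith [hk.nonneg]) Subset.rfl))
  exact injOn_univ.1 ((ncard_image_iff finite_univ).1 hcard)

/-- The intersection controls with error `2 * q`; were it a proper subset of either range, it would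
have at most `p` points. This is why the excluded set carries the error `2 * q`. -/
lemma range_eq_of_controls [CompactSpace B] [T2Space B] (hy : y ∉ controlledSet S p (2 * q)) {k l : Fin (p + 1) → B}
    (hk : Controls S q y (range k)) (hl : Controls S q y (range l)) : range k = range l := by
  have key : ∀ {k l : Fin (p + 1) → B}, Controls S q y (range k) → Controls S q y (range l) →
      range k ⊆ range l := by
    intro k l hk hl
    have : Nonempty B := ⟨k 0⟩
    by_contra hsub
    refine hy (mem_controlledSet_of_ncard_le ((finite_range k).inter_of_left _) ?_
      (two_mul q ▸ hk.inter (finite_range k) (finite_range l) hl))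
    have h1 : (range k ∩ range l).ncard < (range k).ncard :=
      ncard_lt_ncard ⟨inter_subset_left, fun h => hsub fun b hb => (h hb).2⟩ (finite_range k)
    have h2 : (range k).ncard ≤ p + 1 := by
      rw [← image_univ]
      exact (ncard_image_le finite_univ).trans (by simp [ncard_univ])
    omega
  exact (key hk hl).antisymm (key hl hk)

end Unique

end Controls

/-- Limits of controlling tuples at `y` are reorderings of `b`, by uniqueness. So near `y` the tuple
can be ordered to have its `i`-th entry in `V (b i)`, and disjointness of these sets makes the
ordering continuous. -/
lemma exists_local_selection {B Y : Type*} [TopologicalSpace B] [TopologicalSpace Y]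
    [CompactSpace B] [T2Space B] {S : C(B, ℝ) → C(Y, ℝ)} {p : ℕ} {q : ℝ} {H : Set Y}
    (hH : H ⊆ controlledSet S (p + 1) q \ controlledSet S p (2 * q)) {y : Y} (hy : y ∈ H) :
    ∃ U : Set Y, IsOpen U ∧ y ∈ U ∧ ∃ κ : Y → Fin (p + 1) → B, ContinuousOn κ (U ∩ H) ∧
      ∀ z ∈ U ∩ H, Controls S q z (range (κ z)) := by
  obtain ⟨b, hb⟩ := (hH hy).1
  have hbinj := injective_of_controls (hH hy).2 hb
  obtain ⟨V, hV, hVd⟩ := (finite_range b).t2_separation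
  have hdisj : ∀ i j x, x ∈ V (b i) → x ∈ V (b j) → i = j := by
    intro i j x hi hj
    by_contra hne
    exact disjoint_left.1 (hVd (mem_range_self i) (mem_range_self j) (hbinj.ne hne)) hi hj
  have hk : ∀ z, ∃ k : Fin (p + 1) → B, z ∈ H → Controls S q z (range k) := by
    intro z
    by_cases hz : z ∈ H
    · obtain ⟨k, hk⟩ := (hH hz).1
      exact ⟨k, fun _ => hk⟩
    · exact ⟨b, fun h => (hz h).elim⟩
  choose k hk using hk
  have hev : {z | ∃ l : Fin (p + 1) → B, Controls S q z (range l) ∧ ∀ i, l i ∈ V (b i)} ∈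
      𝓝[H] y := by
    rw [mem_iff_ultrafilter]
    intro u hu
    have hu1 : Tendsto id (u : Filter Y) (𝓝 y) := hu.trans nhdsWithin_le_nhds
    have hu2 : H ∈ (u : Filter Y) := hu self_mem_nhdsWithin
    obtain ⟨c, hc, hcy⟩ := exists_tendsto_controls u hu1 k (mem_of_superset hu2 fun z hz => hk z hz)
    have hrange := range_eq_of_controls (hH hy).2 hb hcy
    have hσ : ∀ i, ∃ j, c j = b i := fun i => hrange.subset (mem_range_self i)
    choose σ hσ using hσ
    -- `σ` is a permutation, so reindexing by it does not change the range.
    have hσs : Function.Surjective σ := Finite.surjective_of_injective fun i j hij =>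
      hbinj (by rw [← hσ i, ← hσ j, hij])
    have h1 : ∀ᶠ z in (u : Filter Y), ∀ i, k z (σ i) ∈ V (b i) := by
      refine eventually_all.2 fun i => (tendsto_pi_nhds.1 hc (σ i)).eventually ?_
      rw [hσ i]
      exact (hV _).2.mem_nhds (hV _).1
    filter_upwards [h1, hu2] with z hz1 hz2
    refine ⟨k z ∘ σ, ?_, hz1⟩
    rw [hσs.range_comp]
    exact hk z hz2
  obtain ⟨U, hUo, hyU, hU⟩ := mem_nhdsWithin.1 hev
  have hκ : ∀ z, ∃ l : Fin (p + 1) → B, z ∈ U ∩ H →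
      Controls S q z (range l) ∧ ∀ i, l i ∈ V (b i) := by
    intro z
    by_cases hz : z ∈ U ∩ H
    · obtain ⟨l, hl⟩ := hU hz
      exact ⟨l, fun _ => hl⟩
    · exact ⟨b, fun h => (hz h).elim⟩
  choose κ hκ using hκ
  refine ⟨U, hUo, hyU, κ, fun z hz => ?_, fun z hz => (hκ z hz).1⟩
  refine tendsto_iff_ultrafilter _ _ _ |>.2 fun u hu => ?_
  have hu1 : Tendsto id (u : Filter Y) (𝓝 z) := hu.trans nhdsWithin_le_nhds
  have hu2 : U ∩ H ∈ (u : Filter Y) := hu self_mem_nhdsWithin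
  obtain ⟨c, hc, hcz⟩ := exists_tendsto_controls u hu1 κ
    (mem_of_superset hu2 fun z hz => (hκ z hz).1)
  have hrange := range_eq_of_controls (hH hz.2).2 (hκ z hz).1 hcz
  -- The entry `κ z i` equals some `c j`; nearby `j`-th entries then lie in both `V (b i)` and `V (b
  -- j)`, forcing `j = i`.
  have : c = κ z := by
    funext i
    obtain ⟨j, hj⟩ : κ z i ∈ range c := hrange ▸ mem_range_self i
    have h1 : ∀ᶠ w in (u : Filter Y), κ w j ∈ V (b i) :=
      (tendsto_pi_nhds.1 hc j).eventually ((hV _).2.mem_nhds (hj ▸ (hκ z hz).2 i))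
    obtain ⟨w, hw1, hw2⟩ := (h1.and hu2).exists
    have hji := hdisj j i _ ((hκ w hw2).2 j) hw1
    rw [← hj, hji]
  rwa [← this]

/-! ### Perfectness and finiteness of fibres -/

/-- Bounded lifts have only finitely many patterns of integer parts at the points `c i`, so two of
them share a pattern. -/
lemma LiftsBoundedSeqs.exists_close_lifts {B Y : Type*} [TopologicalSpace B] [TopologicalSpace Y]
    {S : C(B, ℝ) → C(Y, ℝ)} (hS : LiftsBoundedSeqs S) (g : ℕ → C(Y, ℝ))
    (hg : ∃ M, ∀ n y, |g n y| ≤ M) {κ : Type*} [Finite κ] (c : κ → B) :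
    ∃ m n, m ≠ n ∧ ∃ F G, S F = g m ∧ S G = g n ∧ ∀ i, |F (c i) - G (c i)| < 1 := by
  obtain ⟨F, ⟨M, hM⟩, hF⟩ := hS g hg
  let code : ℕ → κ → Icc ⌊-M⌋ ⌊M⌋ := fun n i =>
    ⟨⌊F n (c i)⌋, Int.floor_mono (abs_le.1 (hM n (c i))).1, Int.floor_mono (abs_le.1 (hM n (c i))).2⟩
  obtain ⟨m, n, hmn, hcode⟩ := Finite.exists_ne_map_eq_of_infinite code
  refine ⟨m, n, hmn, F m, F n, hF m, hF n, fun i => ?_⟩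
  exact Int.abs_sub_lt_one_of_floor_eq_floor (congrArg Subtype.val (congrFun hcode i))

/-- A parametrization of controlling tuples is a perfect map with finite fibres. -/
lemma isPerfectFiniteFibres_of_controls {B : Type*} {X Y : Type u} [TopologicalSpace B]
    [TopologicalSpace X] [TopologicalSpace Y] [TopologicalSpace.MetrizableSpace X]
    [TopologicalSpace.MetrizableSpace Y] {S : C(B, ℝ) → C(Y, ℝ)} (hS : LiftsBoundedSeqs S)
    {e : X → B} (he : Continuous e) {n : ℕ} {q : ℝ} {E : Set Y} (hE : IsClosed E)
    {κ : E → Fin n → X} (hκ : Continuous κ)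
    (hc : ∀ y : E, Controls S q (y : Y) (range fun i => e (κ y i))) :
    IsPerfectFiniteFibres κ := by
  let := TopologicalSpace.metrizableSpaceMetric Y
  let := TopologicalSpace.metrizableSpaceMetric X
  refine ⟨isProperMap_iff_isCompact_preimage.2 ⟨hκ, fun K hK => ?_⟩, fun x => ?_⟩
  · rw [isCompact_iff_isSeqCompact]
    intro s hs
    obtain ⟨x, hx, φ, hφ, hlim⟩ := hK.isSeqCompact hs
    by_cases hclus : ∀ y : Y, ¬ MapClusterPt y atTop fun j => ((s (φ j) : E) : Y)
    · exfalso
      obtain ⟨k, hk, hemb⟩ := exists_injective_isClosedEmbedding_comp _ hclus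
      have hq : 0 ≤ q := (hc (s 0)).nonneg
      -- `Nat.unpair` splits the closed discrete sequence into infinitely many infinite classes; the
      -- `m`-th function is `q + 1` on the `m`-th class and 0 on the others.
      have hg : ∀ m : ℕ, ∃ G : C(Y, ℝ), (∀ y, |G y| ≤ q + 1) ∧
          ∀ j, G (s (φ (k j))) = if j.unpair.1 = m then q + 1 else 0 := by
        intro m
        let g : BoundedContinuousFunction ℕ ℝ :=
          BoundedContinuousFunction.ofNormedAddCommGroup
            (fun j => if j.unpair.1 = m then q + 1 else 0)
            continuous_of_discreteTopology (q + 1) (fun j => by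
              split_ifs
              · rw [Real.norm_eq_abs, abs_of_nonneg (by linarith)]
              · rw [norm_zero]; linarith)
        obtain ⟨G, hGn, hG⟩ :=
          BoundedContinuousFunction.exists_extension_norm_eq_of_isClosedEmbedding g hemb
        refine ⟨G.toContinuousMap, fun y => (G.norm_coe_le_norm y).trans ?_, fun j => congrFun hG j⟩
        rw [hGn]
        exact BoundedContinuousFunction.norm_ofNormedAddCommGroup_le _ (by linarith) _
      choose g hgb hg using hg
      obtain ⟨a, b, hab, F, G, hF, hG, hFG⟩ :=
        hS.exists_close_lifts g ⟨q + 1, hgb⟩ fun i => e (x i)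
      have hlim' : Tendsto (fun j => κ (s (φ (k j)))) atTop (𝓝 x) :=
        hlim.comp hk.nat_tendsto_atTop
      have hev : ∀ᶠ j in atTop, ∀ i, |F (e (κ (s (φ (k j))) i)) - G (e (κ (s (φ (k j))) i))| < 1 := by
        refine eventually_all.2 fun i => ?_
        have hi := tendsto_pi_nhds.1 hlim' i
        have hcont : Continuous fun z => |F (e z) - G (e z)| := by fun_prop
        exact ((hcont.tendsto _).comp hi).eventually (gt_mem_nhds (hFG i))
      -- Class `a` is infinite, so it reaches indices where the tuple is close enough to `x` for the
      -- two lifts to be within 1 on it.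
      have hpair : Tendsto (fun l => Nat.pair a l) atTop atTop :=
        Function.Injective.nat_tendsto_atTop fun l l' h => (Nat.pair_eq_pair.1 h).2
      obtain ⟨l, hl⟩ := (hpair.eventually hev).exists
      have := hc (s (φ (k (Nat.pair a l)))) F G (by rintro _ ⟨i, rfl⟩; exact hl i)
      rw [hF, hG, hg, hg, Nat.unpair_pair, if_pos rfl, if_neg hab, sub_zero,
        abs_of_nonneg (by linarith)] at this
      linarith
    · push Not at hclus
      obtain ⟨y, hy⟩ := hclus
      obtain ⟨ψ, hψ, hlimψ⟩ := hy.tendsto_subseq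
      have hyE : y ∈ E := hE.mem_of_tendsto hlimψ (Eventually.of_forall fun j => (s (φ (ψ j))).2)
      have hlimE : Tendsto (fun j => s (φ (ψ j))) atTop (𝓝 ⟨y, hyE⟩) := tendsto_subtype_rng.2 hlimψ
      refine ⟨⟨y, hyE⟩, ?_, φ ∘ ψ, hφ.comp hψ, hlimE⟩
      have := tendsto_nhds_unique ((hκ.tendsto _).comp hlimE) (hlim.comp hψ.tendsto_atTop)
      rw [mem_preimage, this]
      exact hx
  · by_contra hinf
    have : Infinite (κ ⁻¹' {x}) := Set.infinite_coe_iff.2 hinf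
    -- All points of the fibre have the same control, so bumps of height `q + 1` at different points
    -- give the contradiction. The sets `V m` need be disjoint only inside the fibre.
    obtain ⟨O, hOi, hOo, hOd⟩ := exists_seq_infinite_isOpen_pairwise_disjoint (κ ⁻¹' {x})
    choose z hz using fun m => (hOi m).nonempty
    let v : κ ⁻¹' {x} → Y := fun w => ((w : E) : Y)
    have hv : IsInducing v := IsInducing.subtypeVal.comp IsInducing.subtypeVal
    choose V hVo hV using fun m => hv.isOpen_iff.1 (hOo m)
    have hq : 0 ≤ q := (hc (z 0)).nonneg
    have hg : ∀ m, ∃ G : C(Y, ℝ), (∀ y, |G y| ≤ q + 1) ∧ G (v (z m)) = q + 1 ∧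
        ∀ y ∉ V m, G y = 0 := by
      intro m
      have hmem : v (z m) ∈ V m := by
        have := hz m
        rwa [← hV m] at this
      obtain ⟨G, h0, h1, h01⟩ := exists_continuous_zero_one_of_isClosed (hVo m).isClosed_compl
        (isClosed_singleton (x := v (z m))) (disjoint_singleton_right.2 fun h => h hmem)
      refine ⟨(q + 1) • G, fun y => ?_, ?_, fun y hy => ?_⟩
      · rw [ContinuousMap.smul_apply, smul_eq_mul, abs_mul, abs_of_nonneg (by linarith),
          abs_of_nonneg (h01 y).1]
        exact mul_le_of_le_one_right (by linarith) (h01 y).2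
      · simp [h1 (mem_singleton _)]
      · simp [h0 hy]
    choose g hgb hg1 hg0 using hg
    obtain ⟨a, b, hab, F, G, hF, hG, hFG⟩ :=
      hS.exists_close_lifts g ⟨q + 1, hgb⟩ fun i => e (x i)
    have hza : κ (z a) = x := (z a).2
    have := hc (z a) F G (by rintro _ ⟨i, rfl⟩; rw [hza]; exact hFG i)
    have hzero : g b (v (z a)) = 0 := hg0 b _ fun h =>
      disjoint_left.1 (hOd hab) (hz a) (hV b ▸ h)
    rw [hF, hG, hg1, hzero, sub_zero, abs_of_nonneg (by linarith)] at this
    linarith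

/-! ### Countable closed cover of the target -/

/-- The smallest controlling set of a point is contained in every finite controlling set. -/
lemma exists_forall_subset_of_controls {B Y : Type*} [TopologicalSpace B] [TopologicalSpace Y]
    [NormalSpace B] [T1Space B] {S : C(B, ℝ) → C(Y, ℝ)} {y : Y}
    (h : ∃ K : Set B, K.Finite ∧ ∃ q, Controls S q y K) :
    ∃ K : Set B, K.Finite ∧ (∃ q, Controls S q y K) ∧
      ∀ L : Set B, L.Finite → (∃ r, Controls S r y L) → K ⊆ L := by
  classical
  have hex : ∃ n, ∃ K : Set B, K.ncard = n ∧ K.Finite ∧ ∃ q, Controls S q y K := by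
    obtain ⟨K, hK⟩ := h
    exact ⟨_, K, rfl, hK⟩
  obtain ⟨K, hKn, hKf, q, hK⟩ := Nat.find_spec hex
  refine ⟨K, hKf, ⟨q, hK⟩, fun L hLf ⟨r, hL⟩ => ?_⟩
  have hle := Nat.find_min' hex ⟨K ∩ L, rfl, hKf.inter_of_left L, q + r, hK.inter hKf hLf hL⟩
  rw [← hKn] at hle
  exact inter_eq_left.1 (eq_of_subset_of_ncard_le inter_subset_left hle hKf)

lemma exists_closed_cover_isPerfectFiniteFibres {X Y : Type u} [TopologicalSpace X]
    [TopologicalSpace Y] [TopologicalSpace.MetrizableSpace X] [TopologicalSpace.MetrizableSpace Y]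
    {S : C(StoneCech X, ℝ) → C(Y, ℝ)} (hS : LiftsBoundedSeqs S)
    (hfin : ∀ y, ∃ K : Set (StoneCech X), K.Finite ∧ K ⊆ range stoneCechUnit ∧
      ∃ q, Controls S q y K) :
    ∃ E : ℕ → Set Y, (∀ m, IsClosed (E m)) ∧ (⋃ m, E m) = univ ∧
      ∀ m, ∃ n, ∃ κ : E m → Fin (n + 1) → X, IsPerfectFiniteFibres κ := by
  let := TopologicalSpace.metrizableSpaceMetric Y
  let := TopologicalSpace.metrizableSpaceMetric X
  obtain hY | ⟨⟨y₀⟩⟩ := isEmpty_or_nonempty Y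
  · refine ⟨fun _ => ∅, fun _ => isClosed_empty, Subsingleton.elim _ _, fun _ =>
      ⟨0, fun y => y.2.elim, isPerfectFiniteFibres_of_controls (q := 0) hS
        continuous_stoneCechUnit isClosed_empty ?_ fun y => y.2.elim⟩⟩
    exact continuous_iff_continuousAt.2 fun y => y.2.elim
  have hB : Nonempty (StoneCech X) := by
    obtain ⟨K, -, -, q, hK⟩ := hfin y₀
    by_contra hB
    rw [not_nonempty_iff] at hB
    exact not_controls_empty hS q y₀ (hK.mono le_rfl fun b => hB.elim b)
  let W : ℕ → ℕ → Set Y := fun p q =>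
    controlledSet S (p + 1) q \ controlledSet S p (2 * q)
  have hpieces : ∀ p q, ∃ A : ℕ → Set Y, (∀ n, IsClosed (A n)) ∧ ⋃ n, A n = W p q := by
    intro p q
    obtain ⟨A, hAc, -, hA, -⟩ :=
      -- Open sets of a metrizable space are Fσ.
      (isClosed_controlledSet (S := S) p (2 * (q : ℝ))).isOpen_compl.exists_iUnion_isClosed
    refine ⟨fun n => controlledSet S (p + 1) q ∩ A n,
      fun n => (isClosed_controlledSet _ _).inter (hAc n), ?_⟩
    rw [← inter_iUnion, hA]
    rfl
  choose A hAc hA using hpieces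
  have hsub : ∀ p q n, A p q n ⊆ W p q := fun p q n => hA p q ▸ subset_iUnion (A p q) n
  choose E κ hEc hE hκ hR using fun p q n =>
    exists_closed_cover_continuousOn (A p q n) (hAc p q n)
      (fun y (k : Fin (p + 1) → StoneCech X) => Controls S q y (range k))
      fun y hy => exists_local_selection (hsub p q n) hy
  have hEW : ∀ p q n m, E p q n m ⊆ W p q := fun p q n m =>
    ((subset_iUnion _ m).trans (hE p q n).subset).trans (hsub p q n)
  let N : ℕ × ℕ × ℕ × ℕ → Set Y := fun i =>
    {y ∈ E i.1 i.2.1 i.2.2.1 i.2.2.2 |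
      ∀ j, κ i.1 i.2.1 i.2.2.1 i.2.2.2 y j ∈ range stoneCechUnit}
  have hNc : ∀ i, IsClosed (N i) := by
    rintro ⟨p, q, n, m⟩
    refine IsSeqClosed.isClosed fun s y hs hlim => ?_
    have hyE : y ∈ E p q n m := (hEc p q n m).mem_of_tendsto hlim (.of_forall fun l => (hs l).1)
    have hlimκ : Tendsto (fun l => κ p q n m (s l)) atTop (𝓝 (κ p q n m y)) :=
      (hκ p q n m y hyE).tendsto.comp
        (tendsto_nhdsWithin_iff.2 ⟨hlim, .of_forall fun l => (hs l).1⟩)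
    refine ⟨hyE, fun j => ?_⟩
    choose x hx using fun l => (hs l).2 j
    refine mem_range_stoneCechUnit_of_tendsto x _ ?_
    simp only [hx]
    exact tendsto_pi_nhds.1 hlimκ j
  have hNcov : ∀ y, ∃ i, y ∈ N i := by
    intro y
    obtain ⟨L, hLf, hLX, hL⟩ := hfin y
    obtain ⟨K, hKf, ⟨q', hK⟩, hmin⟩ := exists_forall_subset_of_controls ⟨L, hLf, hL⟩
    obtain ⟨q, hq⟩ := exists_nat_ge q'
    have hKq : Controls S q y K := hK.mono hq Subset.rfl
    obtain ⟨p, hp⟩ : ∃ p, K.ncard = p + 1 := by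
      refine Nat.exists_eq_succ_of_ne_zero fun h0 => ?_
      rw [ncard_eq_zero hKf] at h0
      exact not_controls_empty hS q y (h0 ▸ hKq)
    have hyW : y ∈ W p q := by
      refine ⟨mem_controlledSet_of_ncard_le hKf hp.le hKq, ?_⟩
      -- Whatever its error, a controlling set contains the least one `K`, which has `p + 1` points.
      rintro ⟨k, hk⟩
      have h1 := ncard_le_ncard (hmin _ (finite_range k) ⟨_, hk⟩) (finite_range k)
      have h2 : (range k).ncard ≤ p := by
        rw [← image_univ]
        exact (ncard_image_le finite_univ).trans (by simp [ncard_univ])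
      omega
    rw [← hA] at hyW
    obtain ⟨n, hn⟩ := mem_iUnion.1 hyW
    have hn' := hn
    rw [← hE] at hn
    obtain ⟨m, hm⟩ := mem_iUnion.1 hn
    refine ⟨⟨p, q, n, m⟩, hm, fun j => ?_⟩
    obtain ⟨k, hk⟩ : ∃ k : Fin (p + 1) → StoneCech X, range k = K := by
      have hfin' := hKf.fintype
      have : Nonempty (Fin (p + 1) ≃ K) := by
        rw [← Fintype.card_eq, Fintype.card_fin, ← Nat.card_eq_fintype_card]
        exact hp.symm
      obtain ⟨e⟩ := this
      exact ⟨fun i => e i, by rw [show (fun i => (e i : StoneCech X)) = Subtype.val ∘ e from rfl,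
        e.surjective.range_comp, Subtype.range_coe]⟩
    -- By uniqueness the selected tuple enumerates `K`, and `K ⊆ L` with `L` inside `X`.
    have hrange := range_eq_of_controls (hsub p q n hn').2 (hR p q n m y hm) (hk ▸ hKq)
    exact hLX (hmin L hLf hL (hk ▸ hrange.subset (mem_range_self j)))
  obtain ⟨i, hi⟩ := exists_surjective_nat (ℕ × ℕ × ℕ × ℕ)
  refine ⟨fun m => N (i m), fun m => hNc _, ?_, fun l => ?_⟩
  · refine eq_univ_of_forall fun y => ?_
    obtain ⟨a, ha⟩ := hNcov y
    obtain ⟨m, rfl⟩ := hi a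
    exact mem_iUnion.2 ⟨m, ha⟩
  · beta_reduce
    obtain ⟨p, q, n, m⟩ := i l
    choose η hη using fun y : N (p, q, n, m) => y.2.2
    refine ⟨p, η, isPerfectFiniteFibres_of_controls (q := q) hS continuous_stoneCechUnit
      (hNc _) ?_ fun y => ?_⟩
    · refine continuous_pi fun j => isEmbedding_stoneCechUnit.continuous_iff.2 ?_
      have : (stoneCechUnit ∘ fun y => η y j) =
          fun y : N (p, q, n, m) => κ p q n m y j := funext fun y => hη y j
      rw [this]
      exact (continuous_apply j).comp
        (continuousOn_iff_continuous_domRestrict.1 ((hκ p q n m).mono fun y hy => hy.1))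
    · have : (fun j => stoneCechUnit (η y j)) = κ p q n m y := funext fun j => hη y j
      rw [this]
      exact hR p q n m y y.2.1

/-! ### From function spaces to the Stone–Čech compactification -/

lemma FunKind.mem_Dp_of_bounded (D : FunKind) {X : Type u} [TopologicalSpace X] {f : X → ℝ}
    (hf : Continuous f) {M : ℝ} (hM : ∀ x, |f x| ≤ M) : f ∈ D.Dp X := by
  cases D
  · exact hf
  · exact ⟨hf, M, hM⟩

lemma FunKind.continuous_of_mem_Dp {D : FunKind} {X : Type u} [TopologicalSpace X] {f : X → ℝ}
    (hf : f ∈ D.Dp X) : Continuous f := by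
  cases D
  · exact hf
  · exact hf.1

/-- The restriction to `X` of a continuous function on the Stone–Čech compactification. -/
def FunKind.ofStoneCech (D : FunKind) {X : Type u} [TopologicalSpace X] (F : C(StoneCech X, ℝ)) :
    D.Dp X :=
  ⟨fun x => F (stoneCechUnit x), D.mem_Dp_of_bounded
    (F.continuous.comp continuous_stoneCechUnit) fun x => F.norm_coe_le_norm (stoneCechUnit x)⟩

/-- A map between function spaces, viewed on the bounded functions as a map defined on the
continuous functions on the Stone–Čech compactification. -/
def stoneCechLift {D : FunKind} {X Y : Type u} [TopologicalSpace X] [TopologicalSpace Y]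
    (T : D.Dp X → D.Dp Y) (F : C(StoneCech X, ℝ)) : C(Y, ℝ) :=
  ⟨T (D.ofStoneCech F), FunKind.continuous_of_mem_Dp (T (D.ofStoneCech F)).2⟩

lemma liftsBoundedSeqs_stoneCechLift {D : FunKind} {X Y : Type u} [TopologicalSpace X]
    [TopologicalSpace Y] {T : D.Dp X → D.Dp Y} (hT : InverselyBounded T) :
    LiftsBoundedSeqs (stoneCechLift T) := by
  rintro g ⟨M, hM⟩
  obtain ⟨f, ⟨R, -, hR⟩, hf⟩ := hT
    (fun n => ⟨g n, D.mem_Dp_of_bounded (g n).continuous (hM n)⟩)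
    ⟨|M| + 1, by positivity, fun n y => (hM n y).trans ((le_abs_self M).trans (by linarith))⟩
  choose F hF hFR using fun n =>
    exists_stoneCech_extension (f n : X → ℝ) (FunKind.continuous_of_mem_Dp (f n).2) R (hR n)
  refine ⟨F, ⟨R, hFR⟩, fun n => ContinuousMap.ext fun y => ?_⟩
  have : D.ofStoneCech (F n) = f n := Subtype.ext (funext (hF n))
  change (T (D.ofStoneCech (F n)) : Y → ℝ) y = g n y
  rw [this, hf]

/-- Uniform continuity for the topology of pointwise convergence, at one point of the target. -/
lemma exists_finite_forall_abs_sub_lt {X Y : Type*} {V : Submodule ℝ (X → ℝ)}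
    {W : Submodule ℝ (Y → ℝ)} {T : V → W} (hT : UniformContinuous T) (y : Y) :
    ∃ K : Set X, K.Finite ∧ ∃ δ > 0, ∀ f g : V,
      (∀ x ∈ K, |(f : X → ℝ) x - (g : X → ℝ) x| < δ) →
        |(T f : Y → ℝ) y - (T g : Y → ℝ) y| < 1 := by
  have hu : UniformContinuous fun f : V => (T f : Y → ℝ) y :=
    (Pi.uniformContinuous_proj _ y).comp (uniformContinuous_subtype_val.comp hT)
  have hmem := hu (Metric.dist_mem_uniformity one_pos)
  have hbasis : (𝓤 V).HasBasis (fun I : Set X × (X → ℝ) => I.1.Finite ∧ ∀ i ∈ I.1, 0 < I.2 i)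
      fun I => (fun p : V × V => ((p.1 : X → ℝ), (p.2 : X → ℝ))) ⁻¹'
        ⋂ i ∈ I.1, (fun a : (X → ℝ) × (X → ℝ) => (a.1 i, a.2 i)) ⁻¹'
          {p | dist p.1 p.2 < I.2 i} := by
    rw [uniformity_subtype, Pi.uniformity]
    exact (HasBasis.iInf' fun i => Metric.uniformity_basis_dist.comap _).comap _
  obtain ⟨⟨K, ε⟩, ⟨hK, hε⟩, hsub⟩ := hbasis.mem_iff.1 hmem
  have hδ : ∃ δ > 0, ∀ x ∈ K, δ ≤ ε x := by
    obtain rfl | hne := K.eq_empty_or_nonempty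
    · exact ⟨1, one_pos, fun x hx => hx.elim⟩
    · obtain ⟨x, hx, hmin⟩ := exists_min_image K ε hK hne
      exact ⟨ε x, hε x hx, hmin⟩
  obtain ⟨δ, hδ, hδε⟩ := hδ
  refine ⟨K, hK, δ, hδ, fun f g hfg => ?_⟩
  have : (f, g) ∈ (fun p : V × V => ((p.1 : X → ℝ), (p.2 : X → ℝ))) ⁻¹'
        ⋂ i ∈ K, (fun a : (X → ℝ) × (X → ℝ) => (a.1 i, a.2 i)) ⁻¹'
          {p | dist p.1 p.2 < ε i} := by
    simp only [mem_preimage, mem_iInter, mem_ofPred_eq, Real.dist_eq]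
    exact fun x hx => (hfg x hx).trans_le (hδε x hx)
  exact hsub this

/-- Cut the segment from `F` to `G` into `n > 1 / δ` equal steps. Each changes the values on `K` by
less than `δ`, hence the image at `y` by at most 1, and the total error is `n`. -/
lemma exists_controls_stoneCechLift {D : FunKind} {X Y : Type u} [TopologicalSpace X]
    [TopologicalSpace Y] {T : D.Dp X → D.Dp Y} (hT : UniformContinuous T) (y : Y) :
    ∃ K : Set (StoneCech X), K.Finite ∧ K ⊆ range stoneCechUnit ∧
      ∃ q, Controls (stoneCechLift T) q y K := by
  obtain ⟨K, hK, δ, hδ, h⟩ := exists_finite_forall_abs_sub_lt hT y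
  obtain ⟨n, hn⟩ := exists_nat_gt (1 / δ)
  have hn0 : (0 : ℝ) < n := (by positivity : (0 : ℝ) < 1 / δ).trans hn
  refine ⟨stoneCechUnit '' K, hK.image _, image_subset_range _ _, n, fun F G hFG => ?_⟩
  let E : ℕ → C(StoneCech X, ℝ) := fun k => F + ((k : ℝ) / n) • (G - F)
  have hstep : ∀ k, |stoneCechLift T (E k) y - stoneCechLift T (E (k + 1)) y| ≤ 1 := by
    intro k
    refine (h (D.ofStoneCech (E k)) (D.ofStoneCech (E (k + 1))) fun x hx => ?_).le
    have hx' := hFG _ (mem_image_of_mem _ hx)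
    change |E k (stoneCechUnit x) - E (k + 1) (stoneCechUnit x)| < δ
    have : E k (stoneCechUnit x) - E (k + 1) (stoneCechUnit x) =
        (F (stoneCechUnit x) - G (stoneCechUnit x)) / n := by
      simp [E]
      field_simp
      ring
    rw [this, abs_div, abs_of_pos hn0, div_lt_iff₀ hn0]
    rw [div_lt_iff₀ hδ] at hn
    linarith
  have hsum : ∀ k : ℕ, |stoneCechLift T (E 0) y - stoneCechLift T (E k) y| ≤ k := by
    intro k
    induction k with
    | zero => simp
    | succ k ih =>
      push_cast
      exact (abs_sub_le _ _ _).trans (add_le_add ih (hstep k))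
  have h0 : E 0 = F := by simp [E]
  have h1 : E n = G := by simp [E, hn0.ne']
  simpa [h0, h1] using hsum n

theorem theorem1p3
    (X Y : Type u) [TopologicalSpace X] [TopologicalSpace Y]
    [TopologicalSpace.MetrizableSpace X] [TopologicalSpace.MetrizableSpace Y]
    (D : FunKind) (T : D.Dp X → D.Dp Y)
    (hT_unif : UniformContinuous T)
    (hT_inv : InverselyBounded T)
    (hT_surj : Function.Surjective T)
    (P : (Z : Type u) → [TopologicalSpace Z] → Prop)
    (closed_hereditary : ∀ (Z : Type u) [TopologicalSpace Z]
      [TopologicalSpace.MetrizableSpace Z] (F : Set Z), IsClosed F → P Z → P F)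
    (finite_products : ∀ (Z W : Type u) [TopologicalSpace Z] [TopologicalSpace W]
      [TopologicalSpace.MetrizableSpace Z] [TopologicalSpace.MetrizableSpace W],
      P Z → P W → P (Z × W))
    (countable_closed_unions : ∀ (Z : Type u) [TopologicalSpace Z]
      [TopologicalSpace.MetrizableSpace Z] (F : ℕ → Set Z),
      (∀ n, IsClosed (F n)) → (∀ n, P (F n)) → (⋃ n, F n) = Set.univ → P Z)
    (perfect_preimage : ∀ (Z W : Type u) [TopologicalSpace Z] [TopologicalSpace W]
      [TopologicalSpace.MetrizableSpace Z] [TopologicalSpace.MetrizableSpace W] (f : Z → W),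
      IsPerfectFiniteFibres f → P W → P Z)
    (hX : P X) :
    P Y := by
  -- Homeomorphism invariance is not a separate hypothesis: a homeomorphism is a perfect map with
  -- finite fibres.
  have hhomeo : ∀ (Z W : Type u) [TopologicalSpace Z] [TopologicalSpace W]
      [TopologicalSpace.MetrizableSpace Z] [TopologicalSpace.MetrizableSpace W],
      (Z ≃ₜ W) → P W → P Z := fun Z W _ _ _ _ e =>
    perfect_preimage Z W e ⟨e.isProperMap, fun w =>
      ((finite_singleton w).preimage e.injective.injOn)⟩
  have hone : P (Fin 1 → X) := hhomeo _ _ (Homeomorph.funUnique (Fin 1) X) hX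
  have hpow : ∀ n : ℕ, P (Fin (n + 1) → X) := by
    intro n
    induction n with
    | zero => exact hone
    | succ n ih =>
      exact hhomeo _ _ (Fin.appendHomeomorph (n + 1) 1).symm (finite_products _ _ ih hone)
  obtain ⟨E, hEc, hE, hκ⟩ := exists_closed_cover_isPerfectFiniteFibres
    (liftsBoundedSeqs_stoneCechLift hT_inv) (exists_controls_stoneCechLift hT_unif)
  refine countable_closed_unions Y E hEc (fun m => ?_) hE
  obtain ⟨n, κ, hκ⟩ := hκ m
  exact perfect_preimage _ _ κ hκ (hpow n)
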